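/- Let $\mathrm{Var}$ be a countably infinite set of variables and let $\mathscr F$ be the category whose objects (contexts) are the finite subsets $\Gamma\subseteq\mathrm{Var}$ and whose morphisms are all functions between them. A presheaf is a functor $\mathscr F\to\mathrm{Set}$; $V$ is the presheaf $V(\Gamma)=\Gamma$, and $\otimes$ is the substitution tensor product $$(X\otimes Y)(\Gamma)=\int^{\Delta}\mathrm{Set}(\Delta,Y(\Gamma))\bullet X(\Delta).$$ Let $\Sigma$ be a finitary signature (of terminals), and let $F_{\lambda,\Sigma}$ be the presheaf of finite $\lambda$-$\Sigma$-terms in context modulo $\alpha$-conversion (built from variables, application, $\lambda$-abstraction and the operation symbols of $\Sigma$). A higher-order recursion scheme is a presheaf morphism $e\colon X\to F_{\lambda,\Sigma}\otimes(X+V)$ with $X$ a finitely presentable presheaf. Write $\mathrm{CPO}(A,B)$ for the set of continuous functions (those preserving directed joins, i.e. joins of nonempty directed sets) ordered pointwise. Let $D$ be a Scott model: a poset with directed joins and a least element $\bot$, with continuous maps $\mathrm{fold}\colon\mathrm{CPO}(D,D)\to D$ and $\mathrm{unfold}\colon D\to\mathrm{CPO}(D,D)$ such that $\mathrm{unfold}\cdot\mathrm{fold}=\mathrm{id}$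 and $\mathrm{fold}\cdot\mathrm{unfold}\sqsubseteq\mathrm{id}$; and let a continuous operation $\sigma^D\colon D^n\to D$ be given for every $n$-ary $\sigma\in\Sigma$. Let $\langle D,D\rangle$ be the presheaf $\langle D,D\rangle(\Gamma)=\mathrm{CPO}(D^\Gamma,D)$, with the pointing $\iota\colon V\to\langle D,D\rangle$ by projections and the multiplication $m\colon\langle D,D\rangle\otimes\langle D,D\rangle\to\langle D,D\rangle$ that sends the class of $g\in\mathrm{CPO}(D^{\Delta},D)$ and $f\colon\Delta\to\mathrm{CPO}(D^\Gamma,D)$ to $\rho\mapsto g\bigl((f(x)(\rho))_{x\in\Delta}\bigr)$. Let $[\![-]\!]\colon F_{\lambda,\Sigma}\to\langle D,D\rangle$ be the interpretation of terms: $$[\![x]\!]\rho=\rho(x),\quad [\![t\mathbin{@}t']\!]\rho=\mathrm{unfold}([\![t]\!]\rho)([\![t']\!]\rho),\quad [\![\lambda x.t]\!]\rho=\mathrm{fold}\bigl(d\mapsto[\![t]\!](\rho,x\mapsto d)\bigr),\quad [\![\sigma(t_1,\dots,t_n)]\!]\rho=\sigma^D([\![t_1]\!]\rho,\dots,[\![t_n]\!]\rho).$$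 An interpreted solution of $e$ is a presheaf morphism $s\colon X\to\langle D,D\rangle$ with $$s=m\cdot\bigl([\![-]\!]\otimes[s,\iota]\bigr)\cdot e .$$ Theorem. Every higher-order recursion scheme $e\colon X\to F_{\lambda,\Sigma}\otimes(X+V)$ has a least interpreted solution in $\langle D,D\rangle$ with respect to the pointwise order on presheaf morphisms $X\to\langle D,D\rangle$ (that is, $s\le t$ iff $s_\Gamma(x)(\rho)\sqsubseteq t_\Gamma(x)(\rho)$ for all contexts $\Gamma$, all $x\in X(\Gamma)$ and all $\rho\in D^\Gamma$). -/

import Mathlib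

open CategoryTheory

universe u

namespace HORS

/-! ### Contexts and presheaves -/

/-- A context: a finite set of variables from `Var`. -/
structure Ctx (Var : Type u) where
  vars : Finset Var

namespace Ctx

variable {Var : Type u}

instance : CoeSort (Ctx Var) (Type u) := ⟨fun Γ => {x : Var // x ∈ Γ.vars}⟩

/-- Contexts form a full subcategory of sets: morphisms are all functions. -/
instance : Category.{u} (Ctx Var) where
  Hom Γ Δ := Γ → Δ
  id Γ := fun x => x
  comp f g := fun x => g (f x)

variable [Infinite Var]

/-- A chosen variable outside of `Γ`. -/
noncomputable def freshVar (Γ : Ctx Var) : Var :=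
  Classical.choose (Infinite.exists_notMem_finset Γ.vars)

theorem freshVar_notMem (Γ : Ctx Var) : Γ.freshVar ∉ Γ.vars :=
  Classical.choose_spec (Infinite.exists_notMem_finset Γ.vars)

/-- The context `Γ + 1`, that is, `Γ` extended by one fresh variable. -/
noncomputable def succ (Γ : Ctx Var) : Ctx Var :=
  ⟨Finset.cons Γ.freshVar Γ.vars Γ.freshVar_notMem⟩

theorem mem_succ {Γ : Ctx Var} {x : Var} : x ∈ Γ.succ.vars ↔ x = Γ.freshVar ∨ x ∈ Γ.vars :=
  Finset.mem_cons (h := Γ.freshVar_notMem)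

/-- The fresh variable as a member of `Γ + 1`. -/
noncomputable def fresh (Γ : Ctx Var) : Γ.succ :=
  ⟨Γ.freshVar, mem_succ.2 (Or.inl rfl)⟩

/-- The inclusion of `Γ` into `Γ + 1`. -/
noncomputable def weak (Γ : Ctx Var) : Γ ⟶ Γ.succ :=
  fun x => ⟨x.1, mem_succ.2 (Or.inr x.2)⟩

open Classical in
/-- The function on `Γ + 1` that is `f` on `Γ` and takes the value `a` at the fresh variable. -/
noncomputable def extend {Γ : Ctx Var} {A : Type u} (f : Γ → A) (a : A) : Γ.succ → A :=
  fun v => if h : v.1 ∈ Γ.vars then f ⟨v.1, h⟩ else a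

@[simp] theorem extend_weak {Γ : Ctx Var} {A : Type u} (f : Γ → A) (a : A) (x : Γ) :
    extend f a (Γ.weak x) = f x := by
  have h : (Γ.weak x).1 ∈ Γ.vars := x.2
  simp only [extend, h, dite_true]
  rfl

@[simp] theorem extend_fresh {Γ : Ctx Var} {A : Type u} (f : Γ → A) (a : A) :
    extend f a Γ.fresh = a := by
  have h : Γ.fresh.1 ∉ Γ.vars := Γ.freshVar_notMem
  simp only [extend, h, dite_false]

theorem succ_cases {Γ : Ctx Var} (v : Γ.succ) : (∃ x : Γ, v = Γ.weak x) ∨ v = Γ.fresh := by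
  rcases mem_succ.1 v.2 with h | h
  · exact Or.inr (Subtype.ext h)
  · exact Or.inl ⟨⟨v.1, h⟩, rfl⟩

/-- Two functions on `Γ + 1` agree if they agree on `Γ` and at the fresh variable. -/
theorem succ_funext {Γ : Ctx Var} {A : Type u} {f g : Γ.succ → A}
    (h : ∀ x : Γ, f (Γ.weak x) = g (Γ.weak x)) (h' : f Γ.fresh = g Γ.fresh) : f = g := by
  funext v
  rcases succ_cases v with ⟨x, rfl⟩ | rfl
  · exact h x
  · exact h'

/-- The function `γ + 1 : Γ + 1 → Δ + 1`. -/
noncomputable def succMap {Γ Δ : Ctx Var} (γ : Γ ⟶ Δ) : Γ.succ ⟶ Δ.succ :=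
  extend (fun x => Δ.weak (γ x)) Δ.fresh

@[simp] theorem succMap_weak {Γ Δ : Ctx Var} (γ : Γ ⟶ Δ) (x : Γ) :
    succMap γ (Γ.weak x) = Δ.weak (γ x) := extend_weak _ _ _

@[simp] theorem succMap_fresh {Γ Δ : Ctx Var} (γ : Γ ⟶ Δ) :
    succMap γ Γ.fresh = Δ.fresh := extend_fresh _ _

end Ctx

/-- Presheaves ("sets in context"): covariant functors from contexts to sets. -/
abbrev Psh (Var : Type u) := Ctx Var ⥤ Type u

/-- The presheaf of variables, `V(Γ) = Γ`. -/
def V (Var : Type u) : Psh Var where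
  obj Γ := Γ
  map γ := ↾γ
  map_id _ := rfl
  map_comp _ _ := rfl

/-- The coproduct `X + Y` of presheaves; `coprod.desc` is the copairing `[s, t]`. -/
abbrev plus {Var : Type u} (X Y : Psh Var) : Psh Var := FunctorToTypes.coprod X Y

/-! ### The substitution tensor product

`(X ⊗ Y)(Γ)` is the coend over contexts `Δ` of `Set(Δ, Y(Γ)) • X(Δ)`: pairs of an element
`x ∈ X(Δ)` and a function `u : Δ → Y(Γ)`, modulo `(Xγ(x), u) ∼ (x, u ∘ γ)`. -/

section Tensor

variable {Var : Type u}

/-- The elements of the coproduct of which the coend is a quotient. -/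
structure PreTensor (X Y : Psh Var) (Γ : Ctx Var) where
  ctx : Ctx Var
  elt : X.obj ctx
  sub : ctx → Y.obj Γ

/-- The generating relation of the coend. -/
inductive TensorRel (X Y : Psh Var) (Γ : Ctx Var) :
    PreTensor X Y Γ → PreTensor X Y Γ → Prop
  | glue {Δ Δ' : Ctx Var} (γ : Δ ⟶ Δ') (x : X.obj Δ) (u : Δ' → Y.obj Γ) :
      TensorRel X Y Γ ⟨Δ', X.map γ x, u⟩ ⟨Δ, x, fun i => u (γ i)⟩

/-- The set `(X ⊗ Y)(Γ)`. -/
def TensorObj (X Y : Psh Var) (Γ : Ctx Var) : Type u := Quot (TensorRel X Y Γ)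

/-- The element of `(X ⊗ Y)(Γ)` given by `x ∈ X(Δ)` and `u : Δ → Y(Γ)`. -/
def TensorObj.mk {X Y : Psh Var} {Γ : Ctx Var} (Δ : Ctx Var) (x : X.obj Δ) (u : Δ → Y.obj Γ) :
    TensorObj X Y Γ := Quot.mk _ ⟨Δ, x, u⟩

/-- The tensor product `X ⊗ Y` of presheaves. -/
def tensor (X Y : Psh Var) : Psh Var where
  obj Γ := TensorObj X Y Γ
  map {Γ Γ'} γ := ↾(Quot.map (fun p => ⟨p.ctx, p.elt, fun i => Y.map γ (p.sub i)⟩) (by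
    rintro _ _ ⟨δ, x, u⟩
    exact TensorRel.glue δ x (fun i => Y.map γ (u i))))
  map_id Γ := by
    ext ⟨Δ, x, u⟩
    change TensorObj.mk Δ x (fun i => Y.map (𝟙 Γ) (u i)) = TensorObj.mk Δ x u
    simp
  map_comp γ δ := by
    ext ⟨Δ, x, u⟩
    change TensorObj.mk Δ x (fun i => Y.map (γ ≫ δ) (u i)) =
      TensorObj.mk Δ x (fun i => Y.map δ (Y.map γ (u i)))
    simp

/-- The action `a ⊗ b` of the tensor product on presheaf morphisms. -/
def tensorMap {X X' Y Y' : Psh Var} (a : X ⟶ X') (b : Y ⟶ Y') : tensor X Y ⟶ tensor X' Y' where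
  app Γ := ↾(Quot.map (fun p => ⟨p.ctx, a.app p.ctx p.elt, fun i => b.app Γ (p.sub i)⟩) (by
    rintro _ _ ⟨δ, x, u⟩
    have h : a.app _ (X.map δ x) = X'.map δ (a.app _ x) := NatTrans.naturality_apply a δ x
    rw [h]
    exact TensorRel.glue δ (a.app _ x) (fun i => b.app Γ (u i))))
  naturality Γ Γ' γ := by
    ext ⟨Δ, x, u⟩
    change TensorObj.mk Δ (a.app Δ x) (fun i => b.app Γ' (Y.map γ (u i))) =
      TensorObj.mk Δ (a.app Δ x) (fun i => Y'.map γ (b.app Γ (u i)))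
    congr 1
    funext i
    exact NatTrans.naturality_apply b γ (u i)

end Tensor

/-! ### Finite `λ`-`Σ`-terms -/

/-- A finitary signature (of terminals). -/
structure Signature where
  Op : Type u
  arity : Op → ℕ

section Terms

variable {Var : Type u} [Infinite Var]

/-- Finite `λ`-`Σ`-terms in context, modulo `α`-conversion, presented by canonical
representatives: the variable bound by an abstraction in context `Γ` is the chosen fresh
variable of `Γ + 1` (as with de Bruijn levels), so that abstraction is a map from terms in
context `Γ + 1` to terms in context `Γ`. -/
inductive Term (S : Signature.{u}) : Ctx Var → Type u
  | var {Γ : Ctx Var} (x : Γ) : Term S Γ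
  | app {Γ : Ctx Var} (t t' : Term S Γ) : Term S Γ
  | lam {Γ : Ctx Var} (t : Term S Γ.succ) : Term S Γ
  | op {Γ : Ctx Var} (σ : S.Op) (ts : Fin (S.arity σ) → Term S Γ) : Term S Γ

namespace Term

variable {S : Signature.{u}}

/-- Relabelling of free variables. -/
noncomputable def rename : {Γ : Ctx Var} → Term S Γ → {Δ : Ctx Var} → (Γ ⟶ Δ) → Term S Δ
  | _, .var x, _, γ => .var (γ x)
  | _, .app t t', _, γ => .app (t.rename γ) (t'.rename γ)
  | _, .lam t, _, γ => .lam (t.rename (Ctx.succMap γ))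
  | _, .op σ ts, _, γ => .op σ (fun i => (ts i).rename γ)

theorem rename_id {Γ : Ctx Var} (t : Term S Γ) : t.rename (𝟙 Γ) = t := by
  induction t with
  | var x => rfl
  | app t t' h h' => simp only [rename, h, h']
  | @lam Γ t h =>
    have : Ctx.succMap (𝟙 Γ) = 𝟙 Γ.succ :=
      Ctx.succ_funext (fun x => Ctx.succMap_weak _ _) (Ctx.succMap_fresh _)
    simp only [rename, this, h]
  | op σ ts h => simp only [rename, h]

theorem rename_comp {Γ : Ctx Var} (t : Term S Γ) : ∀ {Δ Θ : Ctx Var} (γ : Γ ⟶ Δ) (δ : Δ ⟶ Θ),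
    t.rename (γ ≫ δ) = (t.rename γ).rename δ := by
  induction t with
  | var x => intros; rfl
  | app t t' h h' => intros; simp only [rename, h, h']
  | @lam Γ t h =>
    intro Δ Θ γ δ
    have : Ctx.succMap (γ ≫ δ) = Ctx.succMap γ ≫ Ctx.succMap δ := by
      refine Ctx.succ_funext (fun x => ?_) ?_
      · change _ = Ctx.succMap δ (Ctx.succMap γ (Γ.weak x))
        simp only [Ctx.succMap_weak]
        rfl
      · change _ = Ctx.succMap δ (Ctx.succMap γ Γ.fresh)
        simp only [Ctx.succMap_fresh]
    simp only [rename, this, h]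
  | op σ ts h => intros; simp only [rename, h]

/-- Simultaneous substitution of terms for free variables. -/
noncomputable def subst :
    {Γ : Ctx Var} → Term S Γ → {Δ : Ctx Var} → (Γ → Term S Δ) → Term S Δ
  | _, .var x, _, u => u x
  | _, .app t t', _, u => .app (t.subst u) (t'.subst u)
  | _, .lam t, Δ, u =>
      .lam (t.subst (Ctx.extend (fun x => (u x).rename Δ.weak) (.var Δ.fresh)))
  | _, .op σ ts, _, u => .op σ (fun i => (ts i).subst u)

end Term

/-- The presheaf `F_{λ,Σ}` of finite `λ`-`Σ`-terms. -/
noncomputable def termPsh (Var : Type u) [Infinite Var] (S : Signature.{u}) : Psh Var where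
  obj Γ := Term S Γ
  map γ := ↾(fun t => t.rename γ)
  map_id _ := by ext t; exact t.rename_id
  map_comp γ δ := by ext t; exact t.rename_comp γ δ

end Terms

/-! ### Scott models -/

/-- The poset `CPO(A, B)` of continuous functions (those that preserve joins of nonempty directed
sets), ordered pointwise. -/
abbrev Cont (A B : Type u) [PartialOrder A] [PartialOrder B] : Type u :=
  {f : A → B // ScottContinuous f}

/-- A Scott model: an embedding-projection pair `fold : CPO(D, D) ◁ D : unfold` on a complete
partial order `D` with `⊥`, together with continuous operations interpreting the terminals. -/
structure ScottModel (S : Signature.{u}) (D : Type u) [CompletePartialOrder D] where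
  fold : Cont (Cont D D) D
  unfold : Cont D (Cont D D)
  unfold_fold : ∀ f : Cont D D, unfold.1 (fold.1 f) = f
  fold_unfold_le : ∀ d : D, fold.1 (unfold.1 d) ≤ d
  op : ∀ σ : S.Op, Cont (Fin (S.arity σ) → D) D

section Continuity

variable {A B C : Type u} [PartialOrder A] [PartialOrder B] [PartialOrder C]

theorem scottContinuous_pi {ι : Type*} {f : A → ι → B}
    (h : ∀ i, ScottContinuous (fun a => f a i)) : ScottContinuous f := by
  intro d hne hd a ha
  rw [isLUB_pi]
  intro i
  rw [Set.image_image]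
  exact h i hne hd ha

theorem scottContinuous_eval {ι : Type*} (i : ι) :
    ScottContinuous (fun ρ : ι → B => ρ i) := by
  intro d _ _ a ha
  exact isLUB_pi.1 ha i

theorem scottContinuous_cont {f : A → Cont B C}
    (h : ∀ b, ScottContinuous (fun a => (f a).1 b)) : ScottContinuous f := by
  intro d hne hd a ha
  constructor
  · rintro _ ⟨x, hx, rfl⟩ b
    exact (h b hne hd ha).1 ⟨x, hx, rfl⟩
  · intro g hg b
    refine (h b hne hd ha).2 ?_
    rintro _ ⟨x, hx, rfl⟩
    exact hg ⟨x, hx, rfl⟩ b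

/-- Directed joins of continuous functions are computed pointwise. -/
theorem isLUB_cont_apply {D : Type u} [CompletePartialOrder D] {s : Set (Cont B D)}
    (hd : DirectedOn (· ≤ ·) s) {h : Cont B D} (hh : IsLUB s h) (b : B) :
    IsLUB ((fun f : Cont B D => f.1 b) '' s) (h.1 b) := by
  have hdir : ∀ b, DirectedOn (· ≤ ·) ((fun f : Cont B D => f.1 b) '' s) := by
    rintro b _ ⟨f, hf, rfl⟩ _ ⟨g, hg, rfl⟩
    obtain ⟨k, hk, h1, h2⟩ := hd f hf g hg
    exact ⟨_, ⟨k, hk, rfl⟩, h1 b, h2 b⟩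
  have hlub : ∀ b, IsLUB ((fun f : Cont B D => f.1 b) '' s)
      (sSup ((fun f : Cont B D => f.1 b) '' s)) := fun b => (hdir b).isLUB_sSup
  let k : Cont B D := ⟨fun b => sSup ((fun f : Cont B D => f.1 b) '' s), by
    intro d hne hdd a ha
    constructor
    · rintro _ ⟨x, hx, rfl⟩
      refine (hlub x).2 ?_
      rintro _ ⟨f, hf, rfl⟩
      exact (f.2.monotone (ha.1 hx)).trans ((hlub a).1 ⟨f, hf, rfl⟩)
    · intro c hc
      refine (hlub a).2 ?_
      rintro _ ⟨f, hf, rfl⟩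
      refine (f.2 hne hdd ha).2 ?_
      rintro _ ⟨x, hx, rfl⟩
      exact ((hlub x).1 ⟨f, hf, rfl⟩).trans (hc ⟨x, hx, rfl⟩)⟩
  have hk : IsLUB s k :=
    ⟨fun f hf b => (hlub b).1 ⟨f, hf, rfl⟩, fun g hg b => (hlub b).2 (by
      rintro _ ⟨f, hf, rfl⟩
      exact hg hf b)⟩
  rw [hh.unique hk]
  exact hlub b

theorem scottContinuous_apply {D : Type u} [CompletePartialOrder D] {f : A → Cont B D}
    {g : A → B} (hf : ScottContinuous f) (hg : ScottContinuous g) :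
    ScottContinuous (fun a => (f a).1 (g a)) := by
  intro d hne hd a ha
  constructor
  · rintro _ ⟨x, hx, rfl⟩
    exact ((f x).2.monotone (hg.monotone (ha.1 hx))).trans (hf.monotone (ha.1 hx) (g a))
  · intro c hc
    have hdf : DirectedOn (· ≤ ·) (f '' d) := by
      rintro _ ⟨x, hx, rfl⟩ _ ⟨y, hy, rfl⟩
      obtain ⟨z, hz, h1, h2⟩ := hd x hx y hy
      exact ⟨_, ⟨z, hz, rfl⟩, hf.monotone h1, hf.monotone h2⟩
    have hdg : DirectedOn (· ≤ ·) (g '' d) := by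
      rintro _ ⟨x, hx, rfl⟩ _ ⟨y, hy, rfl⟩
      obtain ⟨z, hz, h1, h2⟩ := hd x hx y hy
      exact ⟨_, ⟨z, hz, rfl⟩, hg.monotone h1, hg.monotone h2⟩
    refine (isLUB_cont_apply hdf (hf hne hd ha) (g a)).2 ?_
    rintro _ ⟨_, ⟨x, hx, rfl⟩, rfl⟩
    refine ((f x).2 (hne.image g) hdg (hg hne hd ha)).2 ?_
    rintro _ ⟨_, ⟨y, hy, rfl⟩, rfl⟩
    obtain ⟨z, hz, h1, h2⟩ := hd x hx y hy
    exact (((f x).2.monotone (hg.monotone h2)).trans (hf.monotone h1 (g z))).trans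
      (hc ⟨z, hz, rfl⟩)

theorem scottContinuous_extend_left {Var : Type u} [Infinite Var] {Γ : Ctx Var} (b : B) :
    ScottContinuous (fun ρ : Γ → B => (Ctx.extend ρ b : Γ.succ → B)) := by
  refine scottContinuous_pi (fun v => ?_)
  rcases Ctx.succ_cases v with ⟨x, rfl⟩ | rfl
  · simpa using scottContinuous_eval x
  · simp

theorem scottContinuous_extend_right {Var : Type u} [Infinite Var] {Γ : Ctx Var} (ρ : Γ → B) :
    ScottContinuous (fun b : B => (Ctx.extend ρ b : Γ.succ → B)) := by
  refine scottContinuous_pi (fun v => ?_)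
  rcases Ctx.succ_cases v with ⟨x, rfl⟩ | rfl
  · simp
  · simp

end Continuity

/-! ### The presheaf `⟨D, D⟩` -/

section Hom

variable (Var : Type u) (D : Type u) [CompletePartialOrder D]

/-- The presheaf `⟨D, D⟩`, with `⟨D, D⟩(Γ) = CPO(D^Γ, D)`. -/
def homPsh : Psh Var where
  obj Γ := Cont (Γ → D) D
  map γ := ↾(fun f => ⟨fun ρ => f.1 (fun x => ρ (γ x)),
    ScottContinuous.comp (scottContinuous_pi fun x => scottContinuous_eval (γ x)) f.2⟩)
  map_id _ := rfl
  map_comp _ _ := rfl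

/-- The pointing `ι : V ⟶ ⟨D, D⟩` by the projections `D^Γ → D`. -/
def iota : V Var ⟶ homPsh Var D where
  app _ := ↾(fun x => ⟨fun ρ => ρ x, scottContinuous_eval x⟩)
  naturality _ _ _ := rfl

/-- The multiplication `m : ⟨D, D⟩ ⊗ ⟨D, D⟩ ⟶ ⟨D, D⟩`: for `g : D^Δ → D` and
`f : Δ → CPO(D^Γ, D)` it yields the composite of `g` with the function `D^Γ → D^Δ` that takes
`ρ` to `x ↦ f x ρ`. -/
def mul : tensor (homPsh Var D) (homPsh Var D) ⟶ homPsh Var D where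
  app Γ := ↾(Quot.lift
    (fun p : PreTensor (homPsh Var D) (homPsh Var D) Γ =>
      (⟨fun ρ => p.elt.1 (fun x => (p.sub x).1 ρ),
        ScottContinuous.comp (scottContinuous_pi fun x => (p.sub x).2) p.elt.2⟩ :
          Cont (Γ → D) D))
    (by rintro _ _ ⟨γ, x, u⟩; rfl))
  naturality _ _ _ := by
    ext ⟨Δ, x, u⟩
    rfl

end Hom

/-! ### The interpretation of terms -/

section Interpretation

variable {Var : Type u} [Infinite Var] {S : Signature.{u}} {D : Type u} [CompletePartialOrder D]

namespace ScottModel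

variable (M : ScottModel S D)

/-- Application on `⟨D, D⟩`. -/
def appOp {Γ : Ctx Var} (f g : (homPsh Var D).obj Γ) : (homPsh Var D).obj Γ :=
  ⟨fun ρ => (M.unfold.1 (f.1 ρ)).1 (g.1 ρ),
    scottContinuous_apply (ScottContinuous.comp f.2 M.unfold.2) g.2⟩

/-- Abstraction `⟨D, D⟩(Γ + 1) → ⟨D, D⟩(Γ)`: currying followed by `fold`. -/
noncomputable def lamOp {Γ : Ctx Var} (f : (homPsh Var D).obj Γ.succ) : (homPsh Var D).obj Γ :=
  ⟨fun ρ => M.fold.1 ⟨fun d => f.1 (Ctx.extend ρ d),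
      ScottContinuous.comp (scottContinuous_extend_right ρ) f.2⟩,
    ScottContinuous.comp (g := M.fold.1)
      (scottContinuous_cont fun d => ScottContinuous.comp (scottContinuous_extend_left d) f.2)
      M.fold.2⟩

/-- The operation on `⟨D, D⟩` given by a terminal. -/
def sigOp {Γ : Ctx Var} (σ : S.Op) (fs : Fin (S.arity σ) → (homPsh Var D).obj Γ) :
    (homPsh Var D).obj Γ :=
  ⟨fun ρ => (M.op σ).1 (fun i => (fs i).1 ρ),
    ScottContinuous.comp (scottContinuous_pi fun i => (fs i).2) (M.op σ).2⟩

/-- The interpretation `⟦t⟧ : D^Γ → D` of a finite term `t` in context `Γ`. -/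
noncomputable def interp : {Γ : Ctx Var} → Term S Γ → (homPsh Var D).obj Γ
  | _, .var x => (iota Var D).app _ x
  | _, .app t t' => M.appOp (interp t) (interp t')
  | _, .lam t => M.lamOp (interp t)
  | _, .op σ ts => M.sigOp σ (fun i => interp (ts i))

theorem interp_rename {Γ : Ctx Var} (t : Term S Γ) : ∀ {Δ : Ctx Var} (γ : Γ ⟶ Δ) (ρ : Δ → D),
    (M.interp (t.rename γ)).1 ρ = (M.interp t).1 (fun x => ρ (γ x)) := by
  induction t with
  | var x => intros; rfl
  | app t t' h h' =>
    intro Δ γ ρ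
    change (M.unfold.1 ((M.interp (t.rename γ)).1 ρ)).1 ((M.interp (t'.rename γ)).1 ρ) = _
    rw [h, h']
    rfl
  | @lam Γ t h =>
    intro Δ γ ρ
    change M.fold.1 ⟨fun d => (M.interp (t.rename (Ctx.succMap γ))).1 (Ctx.extend ρ d), _⟩ =
      M.fold.1 ⟨fun d => (M.interp t).1 (Ctx.extend (fun x => ρ (γ x)) d), _⟩
    refine congrArg M.fold.1 (Subtype.ext (funext fun d => ?_))
    change (M.interp (t.rename (Ctx.succMap γ))).1 (Ctx.extend ρ d) =
      (M.interp t).1 (Ctx.extend (fun x => ρ (γ x)) d)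
    rw [h]
    exact congrArg (M.interp t).1 (Ctx.succ_funext (fun x => by simp) (by simp))
  | op σ ts h =>
    intro Δ γ ρ
    change (M.op σ).1 (fun i => (M.interp ((ts i).rename γ)).1 ρ) = _
    simp only [h]
    rfl

/-- The interpretation `⟦-⟧ : F_{λ,Σ} ⟶ ⟨D, D⟩` of finite terms. -/
noncomputable def sem (Var : Type u) [Infinite Var] (M : ScottModel S D) :
    termPsh Var S ⟶ homPsh Var D where
  app Γ := ↾(fun t => M.interp t)
  naturality Γ Δ γ := by
    ext t
    exact Subtype.ext (funext fun ρ => M.interp_rename t γ ρ)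

/-- The interpretation turns simultaneous substitution into the multiplication of `⟨D, D⟩`. -/
theorem interp_subst {Γ : Ctx Var} (t : Term S Γ) :
    ∀ {Δ : Ctx Var} (u : Γ → Term S Δ),
      M.interp (t.subst u) = (mul Var D).app Δ
        (TensorObj.mk (X := homPsh Var D) (Y := homPsh Var D) Γ (M.interp t)
          (fun x => M.interp (u x))) := by
  suffices h : ∀ {Δ : Ctx Var} (u : Γ → Term S Δ) (ρ : Δ → D),
      (M.interp (t.subst u)).1 ρ = (M.interp t).1 (fun x => (M.interp (u x)).1 ρ) from
    fun {Δ} u => Subtype.ext (funext fun ρ => h u ρ)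
  induction t with
  | var x => intros; rfl
  | app t t' h h' =>
    intro Δ u ρ
    change (M.unfold.1 ((M.interp (t.subst u)).1 ρ)).1 ((M.interp (t'.subst u)).1 ρ) = _
    rw [h, h']
    rfl
  | @lam Γ t h =>
    intro Δ u ρ
    change M.fold.1 ⟨fun d => (M.interp (t.subst
        (Ctx.extend (fun x => (u x).rename Δ.weak) (.var Δ.fresh)))).1 (Ctx.extend ρ d), _⟩ =
      M.fold.1 ⟨fun d => (M.interp t).1
        (Ctx.extend (fun x => (M.interp (u x)).1 ρ) d), _⟩
    refine congrArg M.fold.1 (Subtype.ext (funext fun d => ?_))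
    change (M.interp (t.subst
        (Ctx.extend (fun x => (u x).rename Δ.weak) (.var Δ.fresh)))).1 (Ctx.extend ρ d) =
      (M.interp t).1 (Ctx.extend (fun x => (M.interp (u x)).1 ρ) d)
    rw [h]
    refine congrArg (M.interp t).1 (Ctx.succ_funext (fun x => ?_) ?_)
    · simp [interp_rename]
    · simp only [Ctx.extend_fresh]
      change (Ctx.extend ρ d : Δ.succ → D) Δ.fresh = d
      simp
  | op σ ts h =>
    intro Δ u ρ
    change (M.op σ).1 (fun i => (M.interp ((ts i).subst u)).1 ρ) = _
    simp only [h]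
    rfl

/-- The interpretation is the only map `F_{λ,Σ} → ⟨D, D⟩` that preserves variables, application,
abstraction and the terminals. -/
theorem interp_unique (φ : ∀ {Γ : Ctx Var}, Term S Γ → (homPsh Var D).obj Γ)
    (hvar : ∀ {Γ : Ctx Var} (x : Γ), φ (.var x) = (iota Var D).app Γ x)
    (happ : ∀ {Γ : Ctx Var} (t t' : Term S Γ), φ (.app t t') = M.appOp (φ t) (φ t'))
    (hlam : ∀ {Γ : Ctx Var} (t : Term S Γ.succ), φ (.lam t) = M.lamOp (φ t))
    (hop : ∀ {Γ : Ctx Var} (σ : S.Op) (ts : Fin (S.arity σ) → Term S Γ),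
      φ (.op σ ts) = M.sigOp σ (fun i => φ (ts i)))
    {Γ : Ctx Var} (t : Term S Γ) : φ t = M.interp t := by
  induction t with
  | var x => exact hvar x
  | app t t' h h' => rw [happ, h, h']; rfl
  | lam t h => rw [hlam, h]; rfl
  | op σ ts h => rw [hop]; simp only [h]; rfl

end ScottModel

/-! ### Recursion schemes and interpreted solutions -/

/-- A higher-order recursion scheme on `S`: a presheaf morphism
`e : X ⟶ F_{λ,Σ} ⊗ (X + V)` with `X` finitely presentable. -/
structure RecursionScheme (Var : Type u) [Infinite Var] (S : Signature.{u}) where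
  X : Psh Var
  finitelyPresentable : IsFinitelyPresentable.{u} X
  e : X ⟶ tensor (termPsh Var S) (plus X (V Var))

/-- `s : X ⟶ ⟨D, D⟩` is an interpreted solution of `e` if `s = m · (⟦-⟧ ⊗ [s, ι]) · e`. -/
def IsInterpretedSolution (M : ScottModel S D) (E : RecursionScheme Var S)
    (s : E.X ⟶ homPsh Var D) : Prop :=
  s = E.e ≫ tensorMap (M.sem Var) (FunctorToTypes.coprod.desc s (iota Var D)) ≫ mul Var D

/-- The pointwise order on presheaf morphisms `X ⟶ ⟨D, D⟩`. -/
def PointwiseLE {X : Psh Var} (s t : X ⟶ homPsh Var D) : Prop :=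
  ∀ (Γ : Ctx Var) (x : X.obj Γ) (ρ : Γ → D), (s.app Γ x).1 ρ ≤ (t.app Γ x).1 ρ

end Interpretation

end HORS

/-!
The interpreted solutions of `e` are the fixed points of the operator
`s ↦ m · (⟦-⟧ ⊗ [s, ι]) · e` on presheaf morphisms `X ⟶ ⟨D, D⟩`, and the least one is obtained by
Kleene iteration from the constant morphism `⊥`.

If `e x` is represented by a term `t` in a context `Δ` and a function `u : Δ → X(Γ) + Γ`, the
operator takes `s` at `x` and `ρ` to the value of `⟦t⟧` at the tuple `i ↦ [s, ι](u i)(ρ)`. As `⟦t⟧`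
is a continuous function, the operator is monotone (`solutionOp_mono`) and preserves joins of
ascending sequences (`isLUB_solutionOp`). Joins of ascending sequences of presheaf morphisms exist
and are computed pointwise (`chainSup`): a pointwise join of continuous functions is continuous
because joins commute with joins, and naturality only reindexes `ρ`. Hence the join of the Kleene
iterates is a fixed point, and by monotonicity it lies below every other fixed point.
-/

namespace HORS

variable {Var : Type u} {S : Signature.{u}} {D : Type u} [CompletePartialOrder D]

section Order

variable {X : Psh Var}

theorem isLUB_sSup_range_of_monotone {f : ℕ → D} (hf : Monotone f) :
    IsLUB (Set.range f) (sSup (Set.range f)) :=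
  (directedOn_range.2 hf.directed_le).isLUB_sSup

/-- The least presheaf morphism `X ⟶ ⟨D, D⟩`, with constant value `⊥`, the join of the empty set. -/
def botHom (X : Psh Var) : X ⟶ homPsh Var D where
  app _ := ↾(fun _ => ⟨fun _ => sSup ∅, ScottContinuous.const _⟩)
  naturality _ _ _ := rfl

theorem botHom_le (s : X ⟶ homPsh Var D) : PointwiseLE (botHom X) s := fun _ _ _ =>
  (DirectedOn.isLUB_sSup (d := (∅ : Set D)) (by simp [DirectedOn])).2 (by simp)

theorem app_map_apply (s : X ⟶ homPsh Var D) {Γ Δ : Ctx Var} (γ : Γ ⟶ Δ) (x : X.obj Γ)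
    (ρ : Δ → D) : (s.app Δ (X.map γ x)).1 ρ = (s.app Γ x).1 (fun i => ρ (γ i)) := by
  rw [NatTrans.naturality_apply s γ x]
  rfl

theorem monotone_apply_of_pointwiseLE_succ {c : ℕ → (X ⟶ homPsh Var D)}
    (hc : ∀ n, PointwiseLE (c n) (c (n + 1))) (Γ : Ctx Var) (x : X.obj Γ) (ρ : Γ → D) :
    Monotone (fun n => ((c n).app Γ x).1 ρ) :=
  monotone_nat_of_le_succ fun n => hc n Γ x ρ

theorem scottContinuous_sSup_range {A : Type u} [PartialOrder A] {f : ℕ → A → D}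
    (hf : ∀ a, Monotone (fun n => f n a)) (hcont : ∀ n, ScottContinuous (f n)) :
    ScottContinuous (fun a => sSup (Set.range fun n => f n a)) := by
  intro d hne hd a ha
  constructor
  · rintro _ ⟨b, hb, rfl⟩
    refine (isLUB_sSup_range_of_monotone (hf b)).2 ?_
    rintro _ ⟨n, rfl⟩
    exact ((hcont n).monotone (ha.1 hb)).trans
      ((isLUB_sSup_range_of_monotone (hf a)).1 ⟨n, rfl⟩)
  · intro y hy
    refine (isLUB_sSup_range_of_monotone (hf a)).2 ?_
    rintro _ ⟨n, rfl⟩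
    refine (hcont n hne hd ha).2 ?_
    rintro _ ⟨b, hb, rfl⟩
    exact ((isLUB_sSup_range_of_monotone (hf b)).1 ⟨n, rfl⟩).trans (hy ⟨b, hb, rfl⟩)

/-- The join of an ascending sequence of presheaf morphisms `X ⟶ ⟨D, D⟩`, computed pointwise. -/
def chainSup (c : ℕ → (X ⟶ homPsh Var D)) (hc : ∀ n, PointwiseLE (c n) (c (n + 1))) :
    X ⟶ homPsh Var D where
  app Γ := ↾(fun x => ⟨fun ρ => sSup (Set.range fun n => ((c n).app Γ x).1 ρ),
    scottContinuous_sSup_range (monotone_apply_of_pointwiseLE_succ hc Γ x)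
      fun n => ((c n).app Γ x).2⟩)
  naturality Γ Δ γ := by
    ext x
    refine Subtype.ext (funext fun ρ => ?_)
    change sSup (Set.range fun n => ((c n).app Δ (X.map γ x)).1 ρ) =
      sSup (Set.range fun n => ((c n).app Γ x).1 (fun i => ρ (γ i)))
    simp only [app_map_apply]

theorem isLUB_chainSup (c : ℕ → (X ⟶ homPsh Var D)) (hc : ∀ n, PointwiseLE (c n) (c (n + 1)))
    (Γ : Ctx Var) (x : X.obj Γ) (ρ : Γ → D) :
    IsLUB (Set.range fun n => ((c n).app Γ x).1 ρ) (((chainSup c hc).app Γ x).1 ρ) :=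
  isLUB_sSup_range_of_monotone (monotone_apply_of_pointwiseLE_succ hc Γ x ρ)

/-- The tuple of values in `D` of elements of `X + V`, under the copairing `[s, ι]`. -/
def descEval (s : X ⟶ homPsh Var D) {Γ Δ : Ctx Var} (u : Δ → (plus X (V Var)).obj Γ)
    (ρ : Γ → D) : Δ → D :=
  fun i => ((FunctorToTypes.coprod.desc s (iota Var D)).app Γ (u i)).1 ρ

theorem descEval_mono {s t : X ⟶ homPsh Var D} (h : PointwiseLE s t) {Γ Δ : Ctx Var}
    (u : Δ → (plus X (V Var)).obj Γ) (ρ : Γ → D) : descEval s u ρ ≤ descEval t u ρ := by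
  intro i
  unfold descEval
  rcases u i with x | x
  · exact h Γ x ρ
  · exact le_rfl

theorem isLUB_descEval_chainSup (c : ℕ → (X ⟶ homPsh Var D))
    (hc : ∀ n, PointwiseLE (c n) (c (n + 1))) {Γ Δ : Ctx Var}
    (u : Δ → (plus X (V Var)).obj Γ) (ρ : Γ → D) :
    IsLUB (Set.range fun n => descEval (c n) u ρ) (descEval (chainSup c hc) u ρ) := by
  rw [isLUB_pi]
  intro i
  rw [← Set.range_comp]
  change IsLUB (Set.range fun n => descEval (c n) u ρ i) _
  unfold descEval
  rcases u i with x | x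
  · exact isLUB_chainSup c hc Γ x ρ
  · change IsLUB (Set.range fun _ : ℕ => ρ x) (ρ x)
    rw [Set.range_const]
    exact isLUB_singleton

end Order

section Solution

variable [Infinite Var] (M : ScottModel S D) (E : RecursionScheme Var S)

/-- The operator `s ↦ m · (⟦-⟧ ⊗ [s, ι]) · e`, whose fixed points are the interpreted solutions. -/
noncomputable def solutionOp (s : E.X ⟶ homPsh Var D) : E.X ⟶ homPsh Var D :=
  E.e ≫ tensorMap (M.sem Var) (FunctorToTypes.coprod.desc s (iota Var D)) ≫ mul Var D

variable {E} in
/-- The representative `(t, u)` of `e x` can be chosen independently of `s`. -/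
theorem exists_solutionOp_apply {Γ : Ctx Var} (x : E.X.obj Γ) :
    ∃ (Δ : Ctx Var) (t : Term S Δ) (u : Δ → (plus E.X (V Var)).obj Γ),
      ∀ (s : E.X ⟶ homPsh Var D) (ρ : Γ → D),
        ((solutionOp M E s).app Γ x).1 ρ = (M.interp t).1 (descEval s u ρ) := by
  obtain ⟨⟨Δ, t, u⟩, h⟩ := Quot.exists_rep (E.e.app Γ x : TensorObj _ _ Γ)
  refine ⟨Δ, t, u, fun s ρ => ?_⟩
  change ((mul Var D).app Γ ((tensorMap (M.sem Var)
    (FunctorToTypes.coprod.desc s (iota Var D))).app Γ (E.e.app Γ x))).1 ρ = _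
  rw [← h]
  rfl

theorem solutionOp_mono {s t : E.X ⟶ homPsh Var D} (h : PointwiseLE s t) :
    PointwiseLE (solutionOp M E s) (solutionOp M E t) := by
  intro Γ x ρ
  obtain ⟨Δ, r, u, hr⟩ := exists_solutionOp_apply M x
  rw [hr, hr]
  exact (M.interp r).2.monotone (descEval_mono h u ρ)

theorem isLUB_solutionOp (c : ℕ → (E.X ⟶ homPsh Var D))
    (hc : ∀ n, PointwiseLE (c n) (c (n + 1))) (Γ : Ctx Var) (x : E.X.obj Γ) (ρ : Γ → D) :
    IsLUB (Set.range fun n => ((solutionOp M E (c n)).app Γ x).1 ρ)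
      (((solutionOp M E (chainSup c hc)).app Γ x).1 ρ) := by
  obtain ⟨Δ, t, u, ht⟩ := exists_solutionOp_apply M x
  simp only [ht]
  have hmono : Monotone fun n => descEval (c n) u ρ :=
    monotone_nat_of_le_succ fun n => descEval_mono (hc n) u ρ
  have h := (M.interp t).2 (Set.range_nonempty _) (directedOn_range.2 hmono.directed_le)
    (isLUB_descEval_chainSup c hc u ρ)
  rwa [← Set.range_comp] at h

/-- The Kleene iterates of `solutionOp`, starting from `⊥`. -/
noncomputable def kleeneIter (n : ℕ) : E.X ⟶ homPsh Var D := (solutionOp M E)^[n] (botHom E.X)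

theorem kleeneIter_succ (n : ℕ) :
    kleeneIter M E (n + 1) = solutionOp M E (kleeneIter M E n) :=
  Function.iterate_succ_apply' _ _ _

theorem kleeneIter_le_succ (n : ℕ) : PointwiseLE (kleeneIter M E n) (kleeneIter M E (n + 1)) := by
  induction n with
  | zero => exact botHom_le _
  | succ n ih =>
    rw [kleeneIter_succ M E n, kleeneIter_succ M E (n + 1)]
    exact solutionOp_mono M E ih

theorem kleeneIter_le_of_isInterpretedSolution {t : E.X ⟶ homPsh Var D}
    (ht : IsInterpretedSolution M E t) (n : ℕ) : PointwiseLE (kleeneIter M E n) t := by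
  induction n with
  | zero => exact botHom_le t
  | succ n ih =>
    have ht' : t = solutionOp M E t := ht
    rw [kleeneIter_succ, ht']
    exact solutionOp_mono M E ih

theorem isInterpretedSolution_chainSup_kleeneIter :
    IsInterpretedSolution M E (chainSup (kleeneIter M E) (kleeneIter_le_succ M E)) := by
  change _ = solutionOp M E _
  ext Γ x
  refine Subtype.ext (funext fun ρ => ?_)
  have h := isLUB_solutionOp M E (kleeneIter M E) (kleeneIter_le_succ M E) Γ x ρ
  have h' := isLUB_chainSup (kleeneIter M E) (kleeneIter_le_succ M E) Γ x ρ
  simp only [← kleeneIter_succ] at h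
  refine IsLUB.unique ⟨?_, fun b hb => h'.2 ?_⟩ h
  · rintro _ ⟨n, rfl⟩
    exact h'.1 ⟨n + 1, rfl⟩
  -- The sequence starting at index `1` has the same upper bounds as the whole sequence.
  · rintro _ ⟨n, rfl⟩
    exact (kleeneIter_le_succ M E n Γ x ρ).trans (hb ⟨n, rfl⟩)

end Solution

end HORS

theorem theorem5p8 {Var : Type u} [Countable Var] [Infinite Var] (S : HORS.Signature.{u})
    (D : Type u) [CompletePartialOrder D] (M : HORS.ScottModel S D)
    (E : HORS.RecursionScheme Var S) :
    ∃ s : E.X ⟶ HORS.homPsh Var D, HORS.IsInterpretedSolution M E s ∧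
      ∀ t : E.X ⟶ HORS.homPsh Var D, HORS.IsInterpretedSolution M E t →
        HORS.PointwiseLE s t := by
  refine ⟨_, HORS.isInterpretedSolution_chainSup_kleeneIter M E, fun t ht Γ x ρ => ?_⟩
  refine (HORS.isLUB_chainSup _ _ Γ x ρ).2 ?_
  rintro _ ⟨n, rfl⟩
  exact HORS.kleeneIter_le_of_isInterpretedSolution M E ht n Γ x ρ
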